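/- Let $n\ge 1$ and let $K\subset\mathbb{R}^n$ be a convex body, i.e. a compact convex set with non-empty interior. Let $|K|$ be its Lebesgue measure, let $\mathrm{Cov}(K)$ be its covariance matrix, the $n\times n$ matrix with entries $$\mathrm{Cov}_{ij}(K)=\int_K x_ix_j\,\frac{dx}{|K|}-\int_K x_i\,\frac{dx}{|K|}\int_K x_j\,\frac{dx}{|K|},$$ and put $$\mathcal{C}(K)=\frac{|K|^2}{\det\mathrm{Cov}(K)}.$$ Let $L_K=|K|^{-1/n}\,(\det\mathrm{Cov}(K))^{1/(2n)}$ be the isotropic constant of $K$. Then $$\mathcal{C}(K)\ \ge\ \Big(\frac{\pi}{2e^2n}\Big)^n .$$ Moreover $\mathcal{C}(K)=1/L_K^{2n}$, so this is equivalent to $$L_K\ \le\ e\,\sqrt{\frac{2}{\pi}}\;\sqrt{n},$$ which therefore holds as well. -/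

import Mathlib

open MeasureTheory

noncomputable section

/-- The covariance matrix of `K ⊆ ℝⁿ`,
`Cov_{ij}(K) = ∫_K x_i x_j dx/|K| - (∫_K x_i dx/|K|) (∫_K x_j dx/|K|)`. -/
def bodyCov {n : ℕ} (K : Set (EuclideanSpace ℝ (Fin n))) : Matrix (Fin n) (Fin n) ℝ :=
  Matrix.of fun i j =>
    (∫ x in K, x i * x j) / volume.real K
      - ((∫ x in K, x i) / volume.real K) * ((∫ x in K, x j) / volume.real K)

/-- The functional `𝒞(K) = |K|² / det Cov(K)`. -/
def slicingC {n : ℕ} (K : Set (EuclideanSpace ℝ (Fin n))) : ℝ :=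
  volume.real K ^ 2 / (bodyCov K).det

/-- The isotropic constant `L_K = |K|^{-1/n} (det Cov(K))^{1/(2n)}` of a convex body, that is, the
isotropic constant `(sup f / ∫ f)^{1/n} (det Cov f)^{1/(2n)}` of the log-concave function `f` that
is the indicator function of `K`. -/
def isotropicConst {n : ℕ} (K : Set (EuclideanSpace ℝ (Fin n))) : ℝ :=
  (1 / volume.real K) ^ (1 / (n : ℝ)) * (bodyCov K).det ^ (1 / (2 * (n : ℝ)))

end

/-! Write b for the barycenter of K. Andréief's identity turns n! · det Cov(K) into the average over
K^n of det(x_i - b)², and `abs_det_sub_le` bounds each determinant by n^n |K|, because K contains a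
parallelepiped with edges (x_i - b)/n. Hence 𝒞(K) ≥ n!/n^(2n) ≥ (1/(en))^n, which beats the claimed
bound since π ≤ 2e. The bound on L_K follows by taking roots, once det Cov(K) > 0 is known. -/

/-- Andréief's identity for a single family of functions. -/
theorem integral_det_sq {ι X : Type*} [Fintype ι] [DecidableEq ι] [MeasurableSpace X]
    (μ : Measure X) [SigmaFinite μ] (f : ι → X → ℝ)
    (hf : ∀ i j, Integrable (fun x => f i x * f j x) μ) :
    ∫ x : ι → X, (Matrix.of fun i j => f j (x i)).det ^ 2 ∂(Measure.pi fun _ => μ) =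
      (Fintype.card ι).factorial * (Matrix.of fun i j => ∫ x, f i x * f j x ∂μ).det := by
  set G : Matrix ι ι ℝ := Matrix.of fun i j => ∫ x, f i x * f j x ∂μ with hG
  have expand : ∀ M : Matrix ι ι ℝ,
      M.det = ∑ σ : Equiv.Perm ι, ((Equiv.Perm.sign σ : ℤ) : ℝ) * ∏ i, M i (σ i) := fun M => by
    rw [← Matrix.det_transpose, Matrix.det_apply']; rfl
  have hsq : ∀ x : ι → X, (Matrix.of fun i j => f j (x i)).det ^ 2 =
      ∑ σ : Equiv.Perm ι, ∑ τ : Equiv.Perm ι,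
        ((Equiv.Perm.sign σ : ℤ) : ℝ) * ((Equiv.Perm.sign τ : ℤ) : ℝ) *
          ∏ i, (f (σ i) (x i) * f (τ i) (x i)) := fun x => by
    rw [sq, expand, Finset.sum_mul_sum]
    refine Finset.sum_congr rfl fun σ _ => Finset.sum_congr rfl fun τ _ => ?_
    simp only [Matrix.of_apply, Finset.prod_mul_distrib]
    ring
  have hint : ∀ σ τ : Equiv.Perm ι, Integrable
      (fun x : ι → X => ((Equiv.Perm.sign σ : ℤ) : ℝ) * ((Equiv.Perm.sign τ : ℤ) : ℝ) *
          ∏ i, (f (σ i) (x i) * f (τ i) (x i))) (Measure.pi fun _ => μ) := fun σ τ =>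
    (Integrable.fintype_prod (f := fun i x => f (σ i) x * f (τ i) x)
      fun i => hf (σ i) (τ i)).const_mul _
  simp_rw [hsq]
  rw [integral_finsetSum _ fun σ _ => integrable_finsetSum _ fun τ _ => hint σ τ]
  have hσ : ∀ σ : Equiv.Perm ι, ∫ x : ι → X, ∑ τ : Equiv.Perm ι,
        ((Equiv.Perm.sign σ : ℤ) : ℝ) * ((Equiv.Perm.sign τ : ℤ) : ℝ) *
          ∏ i, (f (σ i) (x i) * f (τ i) (x i)) ∂(Measure.pi fun _ => μ) = G.det := fun σ => by
    rw [integral_finsetSum _ fun τ _ => hint σ τ]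
    have hτ : ∀ τ : Equiv.Perm ι, ∫ x : ι → X,
        ((Equiv.Perm.sign σ : ℤ) : ℝ) * ((Equiv.Perm.sign τ : ℤ) : ℝ) *
          ∏ i, (f (σ i) (x i) * f (τ i) (x i)) ∂(Measure.pi fun _ => μ) =
        ((Equiv.Perm.sign σ : ℤ) : ℝ) *
          (((Equiv.Perm.sign τ : ℤ) : ℝ) * ∏ i, G.submatrix σ id i (τ i)) := fun τ => by
      rw [integral_const_mul, integral_fintype_prod_eq_prod
        (f := fun i x => f (σ i) x * f (τ i) x)]
      simp [hG, mul_assoc]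
    simp_rw [hτ]
    -- Permuting the rows by σ costs a second factor sign σ, which cancels the first; so all n!
    -- values of σ contribute `G.det`.
    rw [← Finset.mul_sum, ← expand, Matrix.det_permute, ← mul_assoc, ← Int.cast_mul,
      ← Units.val_mul, Int.units_mul_self]
    simp
  simp_rw [hσ]
  simp [Fintype.card_perm]

/-- A convex set contains a parallelepiped of edge vectors `(x i - b) / n`. -/
theorem abs_det_sub_le {n : ℕ} (hn : 1 ≤ n) {K : Set (EuclideanSpace ℝ (Fin n))}
    (hK : Convex ℝ K) (hKfin : volume K ≠ ⊤) {b : EuclideanSpace ℝ (Fin n)} (hb : b ∈ K)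
    {x : Fin n → EuclideanSpace ℝ (Fin n)} (hx : ∀ i, x i ∈ K) :
    |(Matrix.of fun i j => x i j - b j : Matrix (Fin n) (Fin n) ℝ).det| ≤
      (n : ℝ) ^ n * volume.real K := by
  have hn0 : (0 : ℝ) < n := by exact_mod_cast hn
  set M : Matrix (Fin n) (Fin n) ℝ := Matrix.of fun i j => x i j - b j with hM
  set A := Matrix.toLpLin 2 2 M.transpose with hA
  -- Side 1/n keeps the coordinate sum at most 1, so the cube sits inside the standard simplex; its
  -- volume is the source of n^n.
  set S : Set (EuclideanSpace ℝ (Fin n)) :=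
    WithLp.ofLp ⁻¹' Set.Icc (0 : Fin n → ℝ) (fun _ => 1 / (n : ℝ)) with hS
  have hAy : ∀ y, A y = ∑ i, y i • (x i - b) := fun y => by
    ext j
    simp [hA, hM, Matrix.toLpLin_apply, Matrix.mulVec, dotProduct, mul_comm]
  have hsub : (fun z => b + z) '' (A '' S) ⊆ K := by
    rintro _ ⟨_, ⟨y, hy, rfl⟩, rfl⟩
    have hy0 : ∀ i, 0 ≤ y i := fun i => hy.1 i
    have hy1 : ∑ i, y i ≤ 1 := by
      calc ∑ i, y i ≤ ∑ _i : Fin n, 1 / (n : ℝ) := Finset.sum_le_sum fun i _ => hy.2 i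
        _ = 1 := by simp [hn0.ne']
    -- A convex combination in which `none` gives b the leftover weight.
    have key : b + A y = ∑ o : Option (Fin n),
        (o.elim (1 - ∑ i, y i) y.ofLp) • (o.elim b x) := by
      rw [Fintype.sum_option, hAy]
      simp only [Option.elim, smul_sub, Finset.sum_sub_distrib, sub_smul, one_smul,
        Finset.sum_smul]
      abel
    simp only [key]
    refine hK.sum_mem ?_ ?_ ?_
    · rintro (_ | i) _
      · simpa using hy1
      · exact hy0 i
    · rw [Fintype.sum_option]; simp
    · rintro (_ | i) _
      · exact hb
      · exact hx i
  have hvolS : volume S = ENNReal.ofReal ((1 / (n : ℝ)) ^ n) := by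
    rw [hS, (PiLp.volume_preserving_ofLp (Fin n)).measure_preimage
      measurableSet_Icc.nullMeasurableSet, Real.volume_Icc_pi]
    rw [ENNReal.ofReal_pow (by positivity)]
    simp
  have hle := measure_mono (μ := volume) hsub
  rw [Set.image_add_left, measure_preimage_add, Measure.addHaar_image_linearMap, hvolS,
    hA, LinearMap.det_toLpLin, Matrix.det_transpose, ← ENNReal.ofReal_mul (abs_nonneg _),
    ENNReal.ofReal_le_iff_le_toReal hKfin, one_div, inv_pow, ← div_eq_mul_inv,
    div_le_iff₀ (by positivity)] at hle
  rw [mul_comm]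
  exact hle

/-- The barycenter of `K`. -/
noncomputable def barycenter {n : ℕ} (K : Set (EuclideanSpace ℝ (Fin n))) :
    EuclideanSpace ℝ (Fin n) :=
  ⨍ x in K, x

section Body

variable {n : ℕ} {K : Set (EuclideanSpace ℝ (Fin n))}

theorem barycenter_apply (hK : IsCompact K) (i : Fin n) :
    barycenter K i = (∫ x in K, x i) / volume.real K := by
  have h := (EuclideanSpace.proj (𝕜 := ℝ) i).integral_comp_comm
    (μ := volume.restrict K) (φ := fun x : EuclideanSpace ℝ (Fin n) => x)
    (continuousOn_id.integrableOn_compact hK)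
  change ∫ x in K, x i = (∫ x in K, x) i at h
  rw [barycenter, setAverage_eq, PiLp.smul_apply, ← h, smul_eq_mul, div_eq_inv_mul]

theorem barycenter_mem (hK : IsCompact K) (hKc : Convex ℝ K) (hK0 : volume K ≠ 0) :
    barycenter K ∈ K :=
  hKc.set_average_mem hK.isClosed hK0 hK.measure_lt_top.ne
    ((ae_restrict_mem hK.measurableSet).mono fun _ h => h)
    (continuousOn_id.integrableOn_compact hK)

theorem bodyCov_apply_eq_centered (hK : IsCompact K) (hK0 : volume K ≠ 0) (i j : Fin n) :
    bodyCov K i j = (volume.real K)⁻¹ *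
      ∫ x in K, (x i - barycenter K i) * (x j - barycenter K j) := by
  have hV : volume.real K ≠ 0 := (ENNReal.toReal_pos hK0 hK.measure_lt_top.ne).ne'
  have int : ∀ f : EuclideanSpace ℝ (Fin n) → ℝ, Continuous f → IntegrableOn f K :=
    fun f hf => hf.continuousOn.integrableOn_compact hK
  have e : ∀ x : EuclideanSpace ℝ (Fin n),
      (x i - barycenter K i) * (x j - barycenter K j) =
        x i * x j - barycenter K j * x i - barycenter K i * x j
          + barycenter K i * barycenter K j := fun x => by ring
  simp_rw [e]
  rw [integral_add (int _ (by fun_prop)) (int _ (by fun_prop)),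
    integral_sub (int _ (by fun_prop)) (int _ (by fun_prop)),
    integral_sub (int _ (by fun_prop)) (int _ (by fun_prop)),
    integral_const_mul, integral_const_mul, setIntegral_const, smul_eq_mul,
    barycenter_apply hK, barycenter_apply hK]
  simp only [bodyCov, Matrix.of_apply]
  field_simp
  ring

/-- Andréief's identity for the centered coordinate functions, whose Gram matrix on K is |K| ·
Cov(K). -/
theorem factorial_mul_det_bodyCov (hK : IsCompact K) (hK0 : volume K ≠ 0) :
    (n.factorial : ℝ) * (bodyCov K).det = ((volume.real K)⁻¹) ^ n *
      ∫ x : Fin n → EuclideanSpace ℝ (Fin n),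
        (Matrix.of fun i j => x i j - barycenter K j : Matrix (Fin n) (Fin n) ℝ).det ^ 2
          ∂(Measure.pi fun _ => volume.restrict K) := by
  have h := integral_det_sq (volume.restrict K)
    (fun (j : Fin n) (x : EuclideanSpace ℝ (Fin n)) => x j - barycenter K j)
    (fun i j => Continuous.continuousOn (by fun_prop) |>.integrableOn_compact hK)
  have hcov : bodyCov K = (volume.real K)⁻¹ • Matrix.of fun i j =>
      ∫ x in K, (x i - barycenter K i) * (x j - barycenter K j) := by
    ext i j
    rw [bodyCov_apply_eq_centered hK hK0]
    rfl
  rw [h, hcov, Matrix.det_smul, Fintype.card_fin]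
  ring

theorem factorial_mul_det_bodyCov_le (hn : 1 ≤ n) (hK : IsCompact K) (hKc : Convex ℝ K)
    (hK0 : volume K ≠ 0) :
    (n.factorial : ℝ) * (bodyCov K).det ≤ ((n : ℝ) ^ n * volume.real K) ^ 2 := by
  have hV : 0 < volume.real K := ENNReal.toReal_pos hK0 hK.measure_lt_top.ne
  have hfin : IsFiniteMeasure (volume.restrict K) := ⟨by simpa using hK.measure_lt_top⟩
  have hae : ∀ᵐ x ∂(Measure.pi fun _ : Fin n => volume.restrict K), ∀ i, x i ∈ K := by
    rw [← Measure.restrict_pi_pi]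
    filter_upwards [ae_restrict_mem (MeasurableSet.univ_pi fun _ => hK.measurableSet)]
      with x hx i using hx i trivial
  rw [factorial_mul_det_bodyCov hK hK0]
  have hle : ∫ x : Fin n → EuclideanSpace ℝ (Fin n),
        (Matrix.of fun i j => x i j - barycenter K j : Matrix (Fin n) (Fin n) ℝ).det ^ 2
          ∂(Measure.pi fun _ => volume.restrict K) ≤
      ∫ _x : Fin n → EuclideanSpace ℝ (Fin n), ((n : ℝ) ^ n * volume.real K) ^ 2
          ∂(Measure.pi fun _ => volume.restrict K) := by
    refine integral_mono_of_nonneg (Filter.Eventually.of_forall fun _ => sq_nonneg _)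
      (integrable_const _) ?_
    filter_upwards [hae] with x hx
    exact sq_le_sq' (abs_le.1 (abs_det_sub_le hn hKc hK.measure_lt_top.ne
      (barycenter_mem hK hKc hK0) hx)).1 (abs_le.1 (abs_det_sub_le hn hKc hK.measure_lt_top.ne
      (barycenter_mem hK hKc hK0) hx)).2
  have hmass : (Measure.pi fun _ : Fin n => (volume.restrict K :
      Measure (EuclideanSpace ℝ (Fin n)))).real Set.univ = volume.real K ^ n := by
    simp [measureReal_def, Measure.pi_univ]
  rw [integral_const, hmass, smul_eq_mul] at hle
  calc _ ≤ ((volume.real K)⁻¹) ^ n *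
        (volume.real K ^ n * ((n : ℝ) ^ n * volume.real K) ^ 2) := by gcongr
    _ = _ := by rw [← mul_assoc, ← mul_pow, inv_mul_cancel₀ hV.ne', one_pow, one_mul]

/-- A nonzero kernel vector v would give the linear form ⟨v, x⟩ zero variance on K, so almost all of
K would lie in a hyperplane through the barycenter, which is null. -/
theorem det_bodyCov_ne_zero (hK : IsCompact K) (hK0 : volume K ≠ 0) :
    (bodyCov K).det ≠ 0 := by
  intro hdet
  obtain ⟨v, hv, hv0⟩ := Matrix.exists_mulVec_eq_zero_iff.2 hdet
  have hV : 0 < volume.real K := ENNReal.toReal_pos hK0 hK.measure_lt_top.ne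
  have int : ∀ f : EuclideanSpace ℝ (Fin n) → ℝ, Continuous f → IntegrableOn f K :=
    fun f hf => hf.continuousOn.integrableOn_compact hK
  have hquad : ∫ x in K, (∑ i, v i * (x i - barycenter K i)) ^ 2 = 0 := by
    have e : ∀ x : EuclideanSpace ℝ (Fin n), (∑ i, v i * (x i - barycenter K i)) ^ 2 =
        ∑ i, ∑ j, v i * v j * ((x i - barycenter K i) * (x j - barycenter K j)) := fun x => by
      rw [sq, Finset.sum_mul_sum]
      exact Finset.sum_congr rfl fun i _ => Finset.sum_congr rfl fun j _ => by ring
    simp_rw [e]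
    rw [integral_finsetSum _ fun i _ => int _ (by fun_prop)]
    refine Finset.sum_eq_zero fun i _ => ?_
    rw [integral_finsetSum _ fun j _ => int _ (by fun_prop)]
    have hi := congrFun hv0 i
    simp only [Matrix.mulVec, dotProduct, bodyCov_apply_eq_centered hK hK0, Pi.zero_apply] at hi
    calc _ = volume.real K * v i * ∑ j, (volume.real K)⁻¹ *
          (∫ x in K, (x i - barycenter K i) * (x j - barycenter K j)) * v j := by
          rw [Finset.mul_sum]
          refine Finset.sum_congr rfl fun j _ => ?_
          rw [integral_const_mul]
          field_simp
      _ = 0 := by rw [hi, mul_zero]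
  rw [setIntegral_eq_zero_iff_of_nonneg_ae (Filter.Eventually.of_forall fun _ => sq_nonneg _)
    (int _ (by fun_prop))] at hquad
  set φ : EuclideanSpace ℝ (Fin n) →ₗ[ℝ] ℝ :=
    ∑ i, v i • (EuclideanSpace.proj (𝕜 := ℝ) i : EuclideanSpace ℝ (Fin n) →L[ℝ] ℝ).toLinearMap
    with hφ
  have hφa : ∀ y, φ y = ∑ i, v i * y i := fun y => by simp [hφ]
  have hnull : volume (AffineSubspace.mk' (barycenter K) (LinearMap.ker φ) :
      Set (EuclideanSpace ℝ (Fin n))) = 0 := by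
    refine Measure.addHaar_affineSubspace _ _ fun htop => hv ?_
    have hker : LinearMap.ker φ = ⊤ := by
      rw [← AffineSubspace.direction_mk' (barycenter K) (LinearMap.ker φ), htop,
        AffineSubspace.direction_top]
    funext i
    have : φ (EuclideanSpace.single i 1) = 0 := by
      rw [LinearMap.ker_eq_top.1 hker, LinearMap.zero_apply]
    simpa [hφa] using this
  have hae : ∀ᵐ x ∂(volume.restrict K),
      x ∈ (AffineSubspace.mk' (barycenter K) (LinearMap.ker φ) :
        Set (EuclideanSpace ℝ (Fin n))) := by
    filter_upwards [hquad] with x hx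
    rw [SetLike.mem_coe, AffineSubspace.mem_mk', LinearMap.mem_ker, hφa]
    simpa using hx
  rw [ae_restrict_iff' hK.measurableSet] at hae
  exact hK0 (measure_mono_null_ae
    (hae.mono fun x hx => hx) hnull)

theorem det_bodyCov_pos (hK : IsCompact K) (hK0 : volume K ≠ 0) : 0 < (bodyCov K).det := by
  refine lt_of_le_of_ne ?_ (det_bodyCov_ne_zero hK hK0).symm
  refine nonneg_of_mul_nonneg_right (a := (n.factorial : ℝ)) ?_ (by positivity)
  rw [factorial_mul_det_bodyCov hK hK0]
  exact mul_nonneg (by positivity) (integral_nonneg fun _ => sq_nonneg _)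

end Body

theorem pi_div_two_exp_sq_pow_le {n : ℕ} (hn : 1 ≤ n) :
    (Real.pi / (2 * Real.exp 1 ^ 2 * (n : ℝ))) ^ n ≤ n.factorial / ((n : ℝ) ^ n) ^ 2 := by
  have hn0 : (0 : ℝ) < n := by exact_mod_cast hn
  have he : (2 : ℝ) ≤ Real.exp 1 := by linarith [Real.add_one_le_exp (1 : ℝ)]
  have hbase : Real.pi / (2 * Real.exp 1 ^ 2 * (n : ℝ)) ≤ (Real.exp 1 * n)⁻¹ := by
    rw [← one_div, div_le_div_iff₀ (by positivity) (by positivity)]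
    nlinarith [Real.pi_le_four, mul_pos (Real.exp_pos 1) hn0]
  -- One term of the exponential series at n gives n! ≥ (n/e)^n.
  have hexp := Real.pow_div_factorial_le_exp (n : ℝ) hn0.le n
  rw [div_le_iff₀ (by positivity), ← Real.exp_one_pow] at hexp
  calc _ ≤ ((Real.exp 1 * n)⁻¹) ^ n := by gcongr
    _ ≤ _ := by
      rw [inv_pow, ← one_div, div_le_div_iff₀ (by positivity) (by positivity), mul_pow, one_mul, sq]
      calc (n : ℝ) ^ n * n ^ n ≤ (Real.exp 1 ^ n * n.factorial) * n ^ n := by gcongr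
        _ = _ := by ring

theorem slicingC_eq_one_div_pow {n : ℕ} (hn : 1 ≤ n) {K : Set (EuclideanSpace ℝ (Fin n))}
    (hdet : 0 < (bodyCov K).det) :
    slicingC K = 1 / isotropicConst K ^ (2 * n) := by
  have hn0 : (n : ℝ) ≠ 0 := by positivity
  have h1 : ((1 / volume.real K) ^ (1 / (n : ℝ))) ^ (2 * n) = (1 / volume.real K) ^ 2 := by
    rw [mul_comm, pow_mul, ← Real.rpow_mul_natCast (by positivity), one_div_mul_cancel hn0,
      Real.rpow_one]
  have h2 : ((bodyCov K).det ^ (1 / (2 * (n : ℝ)))) ^ (2 * n) = (bodyCov K).det := by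
    rw [← Real.rpow_mul_natCast hdet.le, Nat.cast_mul, Nat.cast_ofNat,
      one_div_mul_cancel (by positivity), Real.rpow_one]
  rw [slicingC, isotropicConst, mul_pow, h1, h2]
  simp [div_eq_mul_inv, mul_comm]

theorem corollary1p12 (n : ℕ) (hn : 1 ≤ n) (K : ConvexBody (EuclideanSpace ℝ (Fin n)))
    (hK : (interior (K : Set (EuclideanSpace ℝ (Fin n)))).Nonempty) :
    slicingC (K : Set (EuclideanSpace ℝ (Fin n)))
        ≥ (Real.pi / (2 * Real.exp 1 ^ 2 * (n : ℝ))) ^ n ∧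
      slicingC (K : Set (EuclideanSpace ℝ (Fin n)))
        = 1 / isotropicConst (K : Set (EuclideanSpace ℝ (Fin n))) ^ (2 * n) ∧
      isotropicConst (K : Set (EuclideanSpace ℝ (Fin n)))
        ≤ Real.exp 1 * Real.sqrt (2 / Real.pi) * Real.sqrt (n : ℝ) := by
  have hn0 : (0 : ℝ) < n := by exact_mod_cast hn
  have hK0 : volume (K : Set (EuclideanSpace ℝ (Fin n))) ≠ 0 :=
    (Measure.measure_pos_of_nonempty_interior volume hK).ne'
  have hV : 0 < volume.real (K : Set (EuclideanSpace ℝ (Fin n))) :=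
    ENNReal.toReal_pos hK0 K.isCompact.measure_lt_top.ne
  have hdet := det_bodyCov_pos K.isCompact hK0
  have hC : slicingC (K : Set (EuclideanSpace ℝ (Fin n))) ≥
      (Real.pi / (2 * Real.exp 1 ^ 2 * (n : ℝ))) ^ n := by
    refine (pi_div_two_exp_sq_pow_le hn).trans ?_
    rw [slicingC, div_le_div_iff₀ (by positivity) hdet, mul_comm (_ ^ 2), ← mul_pow]
    exact factorial_mul_det_bodyCov_le hn K.isCompact K.convex hK0
  have heq := slicingC_eq_one_div_pow hn hdet
  refine ⟨hC, heq, ?_⟩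
  have hL : 0 < isotropicConst (K : Set (EuclideanSpace ℝ (Fin n))) :=
    mul_pos (Real.rpow_pos_of_pos (by positivity) _) (Real.rpow_pos_of_pos hdet _)
  refine le_of_pow_le_pow_left₀ two_ne_zero (by positivity) ?_
  have hsq : (Real.exp 1 * Real.sqrt (2 / Real.pi) * Real.sqrt (n : ℝ)) ^ 2 =
      (Real.pi / (2 * Real.exp 1 ^ 2 * (n : ℝ)))⁻¹ := by
    rw [mul_pow, mul_pow, Real.sq_sqrt (by positivity), Real.sq_sqrt hn0.le]
    have := Real.pi_pos
    field_simp
  rw [hsq]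
  -- Having squared to remove the roots, compare n-th powers: this is the bound on 𝒞(K) inverted.
  refine le_of_pow_le_pow_left₀ (n := n) (by omega) (by positivity) ?_
  rw [heq, pow_mul, ge_iff_le, le_div_iff₀ (by positivity)] at hC
  rw [inv_pow, ← one_div, le_div_iff₀ (by positivity), mul_comm]
  exact hC
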